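/- Let $(M,g)$ be a smooth Riemannian manifold (Hausdorff, second countable, without boundary, not necessarily compact, connected or complete) with Riemannian volume measure $\upsilon_g$. Let $$C^2_1(M)=\Big\{f\in C^\infty(M):\ \int_M f^2\,\upsilon_g<\infty,\ \int_M\|\nabla f\|^2\,\upsilon_g<\infty\Big\},\qquad \|f\|_{H^1}=\Big(\int_M f^2\,\upsilon_g+\int_M\|\nabla f\|^2\,\upsilon_g\Big)^{1/2},$$ and let the Sobolev space $H^1(M)$ be the completion of $C^2_1(M)$ with respect to $\|\cdot\|_{H^1}$. Let $X$ be a smooth vector field on $M$ with compact support, acting on smooth functions as the derivation $f\mapsto Xf=df(X)$, and let $\|X\|_\infty=\sup_{x\in M}\|X_x\|$. Then there is a unique bounded linear operator $T:H^1(M)\to L^2(M,\upsilon_g)$ with $Tf=Xf$ for every $f\in C^2_1(M)$, and its operator norm satisfies $|||T|||\le\|X\|_\infty$. -/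

import Mathlib

open MeasureTheory
open scoped Manifold ContDiff Bundle ENNReal

noncomputable section

namespace RiemannianSobolev

/-- The Euclidean space `ℝⁿ`, the model space of `n`-dimensional manifolds. -/
abbrev Model (n : ℕ) : Type := EuclideanSpace ℝ (Fin n)

/-- The algebra `C^∞(M)` of smooth real functions on `M`. -/
abbrev Smooth (n : ℕ) (M : Type*) [TopologicalSpace M] [ChartedSpace (Model n) M] : Type _ :=
  C^∞⟮𝓡 n, M; 𝓘(ℝ, ℝ), ℝ⟯

/-- Smooth vector fields on `M`: the smooth sections of the tangent bundle. -/
abbrev VectorField (n : ℕ) (M : Type*) [TopologicalSpace M] [ChartedSpace (Model n) M]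
    [IsManifold (𝓡 n) ∞ M] : Type _ :=
  Cₛ^∞⟮𝓡 n; Model n, fun x : M => TangentSpace (𝓡 n) x⟯

section Derivations

variable {n : ℕ} {M : Type*} [TopologicalSpace M] [ChartedSpace (Model n) M]

lemma Smooth.mdifferentiableAt (f : Smooth n M) (x : M) :
    MDifferentiableAt (𝓡 n) 𝓘(ℝ, ℝ) f x :=
  f.contMDiff.mdifferentiable (by simp) x

lemma contMDiffAt_mvfderiv_apply [IsManifold (𝓡 n) ∞ M] (f : Smooth n M)
    {V : Π y : M, TangentSpace (𝓡 n) y} {x : M}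
    (hV : ContMDiffAt (𝓡 n) ((𝓡 n).prod (𝓡 n)) ∞
      (fun y => (⟨y, V y⟩ : TangentBundle (𝓡 n) M)) x) :
    ContMDiffAt (𝓡 n) 𝓘(ℝ, ℝ) ∞ (fun y => mvfderiv (𝓡 n) f y (V y)) x := by
  have h1 : ContMDiff (𝓡 n).tangent 𝓘(ℝ, ℝ).tangent ∞ (tangentMap (𝓡 n) 𝓘(ℝ, ℝ) f) :=
    f.contMDiff.contMDiff_tangentMap le_rfl
  have h2 := (h1 _).comp x hV
  rw [Bundle.contMDiffAt_totalSpace] at h2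
  convert! h2.2 using 2
  simp
  rfl

/-- The function `X f : x ↦ d_x f (X_x)`. -/
def applyField [IsManifold (𝓡 n) ∞ M] (X : VectorField n M) (f : Smooth n M) : Smooth n M :=
  ⟨fun x => mvfderiv (𝓡 n) f x (X x), fun x => contMDiffAt_mvfderiv_apply f (X.contMDiff x)⟩

lemma applyField_apply [IsManifold (𝓡 n) ∞ M] (X : VectorField n M) (f : Smooth n M) (x : M) :
    applyField X f x = mvfderiv (𝓡 n) f x (X x) := rfl

lemma mvfderiv_const_smul (c : ℝ) (f : Smooth n M) (x : M) :
    mvfderiv (𝓡 n) (c • f : Smooth n M) x = c • mvfderiv (𝓡 n) f x := by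
  have := mvfderiv_smul (I := 𝓡 n) (a := fun _ : M => c) mdifferentiableAt_const
    (f.mdifferentiableAt x)
  have e : ⇑(c • f) = (fun _ : M => c) • ⇑f := rfl
  rw [e, this, mvfderiv_const]
  ext v
  simp

/-- A vector field, seen as the derivation `f ↦ X f` of the algebra of smooth functions. -/
def VectorField.toDerivation [IsManifold (𝓡 n) ∞ M] (X : VectorField n M) :
    Derivation ℝ (Smooth n M) (Smooth n M) :=
  Derivation.mk'
    { toFun := applyField X
      map_add' := fun f h => by
        ext x
        rw [applyField_apply, ContMDiffMap.coe_add,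
          mvfderiv_add (f.mdifferentiableAt x) (h.mdifferentiableAt x)]
        rfl
      map_smul' := fun c f => by
        ext x
        rw [applyField_apply, mvfderiv_const_smul]
        rfl }
    (fun f h => by
      ext x
      change applyField X (f * h) x = f x * applyField X h x + h x * applyField X f x
      rw [applyField_apply, ContMDiffMap.coe_mul,
        mvfderiv_mul (f.mdifferentiableAt x) (h.mdifferentiableAt x)]
      rfl)

end Derivations

section Metric

variable {n : ℕ} {M : Type*} [TopologicalSpace M] [ChartedSpace (Model n) M]
  [Bundle.RiemannianBundle (fun x : M => TangentSpace (𝓡 n) x)]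

/-- The gradient `∇f`: the tangent vector at `x` with `g(∇f, v) = d_x f (v)` for all `v`. -/
def gradient (f : M → ℝ) (x : M) : TangentSpace (𝓡 n) x :=
  haveI : FiniteDimensional ℝ (TangentSpace (𝓡 n) x) :=
    inferInstanceAs (FiniteDimensional ℝ (Model n))
  haveI : CompleteSpace (TangentSpace (𝓡 n) x) := FiniteDimensional.complete ℝ _
  (InnerProductSpace.toDual ℝ (TangentSpace (𝓡 n) x)).symm (mvfderiv (𝓡 n) f x)

lemma inner_gradient (f : M → ℝ) (x : M) (v : TangentSpace (𝓡 n) x) :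
    inner ℝ (gradient f x) v = mvfderiv (𝓡 n) f x v := by
  simp [gradient]

lemma gradient_add (f h : Smooth n M) (x : M) :
    gradient (n := n) (f + h : Smooth n M) x = gradient (n := n) f x + gradient (n := n) h x := by
  refine ext_inner_right ℝ fun v => ?_
  rw [inner_add_left, inner_gradient, inner_gradient, inner_gradient, ContMDiffMap.coe_add,
    mvfderiv_add (f.mdifferentiableAt x) (h.mdifferentiableAt x)]
  rfl

lemma gradient_smul (c : ℝ) (f : Smooth n M) (x : M) :
    gradient (n := n) (c • f : Smooth n M) x = c • gradient (n := n) f x := by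
  refine ext_inner_right ℝ fun v => ?_
  rw [real_inner_smul_left, inner_gradient, inner_gradient, mvfderiv_const_smul]
  rfl

/-- The sup norm `‖X‖_∞ = sup_x ‖X_x‖` of a vector field. -/
def VectorField.supNorm [IsManifold (𝓡 n) ∞ M] (X : VectorField n M) : ℝ :=
  ⨆ x : M, ‖X x‖

/-- The Gram matrix `g_{ij} = g(∂_i, ∂_j)` of the metric in the chart `e`, as a function of the
coordinates `y`. -/
def gramMatrix (e : OpenPartialHomeomorph M (Model n)) (y : Model n) :
    Matrix (Fin n) (Fin n) ℝ :=
  Matrix.of fun i j =>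
    inner ℝ
      (mfderiv (𝓡 n) (𝓡 n) e.symm y
        ((NormedSpace.fromTangentSpace y).symm (EuclideanSpace.single i 1)))
      (mfderiv (𝓡 n) (𝓡 n) e.symm y
        ((NormedSpace.fromTangentSpace y).symm (EuclideanSpace.single j 1)))

variable [MeasurableSpace M]

/-- The measure `√(det g_{ij}) dy¹ ⋯ dyⁿ` on the domain of the chart `e`, transported to `M`
(and extended by zero outside the domain of `e`). -/
def chartVolume (e : OpenPartialHomeomorph M (Model n)) : Measure M :=
  ((volume.restrict e.target).withDensity
    fun y => ENNReal.ofReal (Real.sqrt (gramMatrix e y).det)).map e.symm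

/-- The Riemannian volume measure `υ_g`. The measures `chartVolume e`, for `e` in the atlas, agree
on overlaps of chart domains by the change of variables formula; on a second countable manifold
their supremum in the lattice of measures is the unique measure that restricts to `chartVolume e`
on the domain of each of the charts `e`. -/
def riemannianVolume (n : ℕ) (M : Type*) [TopologicalSpace M] [ChartedSpace (Model n) M]
    [Bundle.RiemannianBundle (fun x : M => TangentSpace (𝓡 n) x)] [MeasurableSpace M] :
    Measure M :=
  ⨆ x : M, chartVolume (chartAt (Model n) x)

end Metric

section Sobolev

variable {n : ℕ} {M : Type*} [TopologicalSpace M] [ChartedSpace (Model n) M]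
  [IsManifold (𝓡 n) ∞ M] [Bundle.RiemannianBundle (fun x : M => TangentSpace (𝓡 n) x)]
  [IsContMDiffRiemannianBundle (𝓡 n) ∞ (Model n) (fun x : M => TangentSpace (𝓡 n) x)]

lemma lowerSemicontinuous_norm_gradient (f : Smooth n M) :
    LowerSemicontinuous fun x => ‖gradient (n := n) f x‖ := by
  intro x c hc
  by_cases hv : gradient (n := n) f x = 0
  · simp only [hv, norm_zero] at hc
    exact Filter.Eventually.of_forall fun y => hc.trans_le (norm_nonneg _)
  set V : Π y : M, TangentSpace (𝓡 n) y :=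
    FiberBundle.extend (Model n) (gradient (n := n) f x) with hVdef
  have hVx : V x = gradient (n := n) f x := by simp [hVdef]
  have hV : ContMDiffAt (𝓡 n) ((𝓡 n).prod (𝓡 n)) ∞
      (fun y => (⟨y, V y⟩ : TangentBundle (𝓡 n) M)) x :=
    FiberBundle.contMDiffAt_extend (𝓡 n) (Model n) _
  have h1 : ContinuousAt (fun y => mvfderiv (𝓡 n) f y (V y)) x :=
    (contMDiffAt_mvfderiv_apply f hV).continuousAt
  have h2 : ContinuousAt (fun y => ‖V y‖) x := by
    have : ContinuousAt (fun y => inner ℝ (V y) (V y)) x := (hV.inner_bundle hV).continuousAt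
    simpa only [norm_eq_sqrt_real_inner] using this.sqrt
  have h3 := h1.div h2 (by simpa [hVx] using hv)
  have h4 : c < mvfderiv (𝓡 n) f x (V x) / ‖V x‖ := by
    rw [← inner_gradient, hVx, real_inner_self_eq_norm_sq, pow_two, mul_self_div_self]
    exact hc
  filter_upwards [h3.eventually_const_lt h4] with y hy
  refine hy.trans_le (div_le_of_le_mul₀ (norm_nonneg _) (norm_nonneg _) ?_)
  change mvfderiv (𝓡 n) f y (V y) ≤ ‖gradient (n := n) f y‖ * ‖V y‖
  rw [← inner_gradient]
  exact real_inner_le_norm _ _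

variable [MeasurableSpace M] [BorelSpace M]

lemma measurable_norm_gradient (f : Smooth n M) :
    Measurable fun x => ‖gradient (n := n) f x‖ :=
  (lowerSemicontinuous_norm_gradient f).measurable

lemma measurable_inner_gradient (f h : Smooth n M) :
    Measurable fun x => inner ℝ (gradient (n := n) f x) (gradient (n := n) h x) := by
  have e : (fun x => inner ℝ (gradient (n := n) f x) (gradient (n := n) h x)) = fun x =>
      (‖gradient (n := n) (f + h : Smooth n M) x‖ * ‖gradient (n := n) (f + h : Smooth n M) x‖
        - ‖gradient (n := n) f x‖ * ‖gradient (n := n) f x‖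
        - ‖gradient (n := n) h x‖ * ‖gradient (n := n) h x‖) / 2 := by
    ext x
    rw [gradient_add, real_inner_eq_norm_add_mul_self_sub_norm_mul_self_sub_norm_mul_self_div_two]
  rw [e]
  have h1 := measurable_norm_gradient (f + h)
  have h2 := measurable_norm_gradient f
  have h3 := measurable_norm_gradient h
  fun_prop

/-- The space of smooth functions `f` such that both `f` and `‖∇f‖` are square integrable. -/
def smoothSobolev (n : ℕ) (M : Type*) [TopologicalSpace M] [ChartedSpace (Model n) M]
    [IsManifold (𝓡 n) ∞ M] [Bundle.RiemannianBundle (fun x : M => TangentSpace (𝓡 n) x)]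
    [IsContMDiffRiemannianBundle (𝓡 n) ∞ (Model n) (fun x : M => TangentSpace (𝓡 n) x)]
    [MeasurableSpace M] [BorelSpace M] : Submodule ℝ (Smooth n M) where
  carrier := {f | MemLp f 2 (riemannianVolume n M) ∧
    MemLp (fun x => ‖gradient (n := n) f x‖) 2 (riemannianVolume n M)}
  zero_mem' := by
    have hz (x : M) : gradient (n := n) (0 : Smooth n M) x = 0 := by
      simpa using gradient_smul (n := n) 0 (0 : Smooth n M) x
    refine ⟨MemLp.zero, ?_⟩
    simp only [hz, norm_zero]
    exact MemLp.zero
  add_mem' := fun {f h} hf hh => by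
    refine ⟨hf.1.add hh.1, (hf.2.add hh.2).mono
      (measurable_norm_gradient (f + h)).aestronglyMeasurable (ae_of_all _ fun x => ?_)⟩
    rw [gradient_add, norm_norm]
    exact (norm_add_le _ _).trans (le_abs_self _)
  smul_mem' := fun c f hf => by
    refine ⟨hf.1.const_smul c, ?_⟩
    simp only [gradient_smul, norm_smul]
    exact hf.2.const_mul _

lemma integrable_mul (f h : smoothSobolev n M) :
    Integrable (fun x => f.1 x * h.1 x) (riemannianVolume n M) :=
  f.2.1.integrable_mul h.2.1

lemma integrable_inner_gradient (f h : smoothSobolev n M) :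
    Integrable (fun x => inner ℝ (gradient (n := n) f.1 x) (gradient (n := n) h.1 x))
      (riemannianVolume n M) :=
  (f.2.2.integrable_mul h.2.2).mono (measurable_inner_gradient f.1 h.1).aestronglyMeasurable
    (ae_of_all _ fun _ => (norm_inner_le_norm _ _).trans (le_abs_self _))

/-- The bilinear form `⟨f, h⟩ = ∫ f h υ_g + ∫ g(∇f, ∇h) υ_g`. -/
@[reducible]
def sobolevCore (n : ℕ) (M : Type*) [TopologicalSpace M] [ChartedSpace (Model n) M]
    [IsManifold (𝓡 n) ∞ M] [Bundle.RiemannianBundle (fun x : M => TangentSpace (𝓡 n) x)]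
    [IsContMDiffRiemannianBundle (𝓡 n) ∞ (Model n) (fun x : M => TangentSpace (𝓡 n) x)]
    [MeasurableSpace M] [BorelSpace M] : PreInnerProductSpace.Core ℝ (smoothSobolev n M) where
  inner f h := ∫ x, f.1 x * h.1 x ∂(riemannianVolume n M) +
    ∫ x, inner ℝ (gradient (n := n) f.1 x) (gradient (n := n) h.1 x) ∂(riemannianVolume n M)
  conj_inner_symm f h := by
    simp only [conj_trivial, mul_comm (f.1 _), real_inner_comm]
  re_inner_nonneg f := by
    refine add_nonneg (integral_nonneg fun _ => mul_self_nonneg _)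
      (integral_nonneg fun _ => real_inner_self_nonneg)
  add_left f h k := by
    have e1 : ∀ x, (f + h).1 x * k.1 x = f.1 x * k.1 x + h.1 x * k.1 x := fun x => add_mul _ _ _
    have e2 : ∀ x, inner ℝ (gradient (n := n) (f + h).1 x) (gradient (n := n) k.1 x) =
        inner ℝ (gradient (n := n) f.1 x) (gradient (n := n) k.1 x) +
        inner ℝ (gradient (n := n) h.1 x) (gradient (n := n) k.1 x) := fun x => by
      rw [← inner_add_left, ← gradient_add]
      rfl
    simp only [e1, e2]
    rw [integral_add (integrable_mul f k) (integrable_mul h k),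
      integral_add (integrable_inner_gradient f k) (integrable_inner_gradient h k)]
    ring
  smul_left f h c := by
    have e1 : ∀ x, (c • f).1 x * h.1 x = c * (f.1 x * h.1 x) := fun x => mul_assoc _ _ _
    have e2 : ∀ x, inner ℝ (gradient (n := n) (c • f).1 x) (gradient (n := n) h.1 x) =
        c * inner ℝ (gradient (n := n) f.1 x) (gradient (n := n) h.1 x) := fun x => by
      rw [← real_inner_smul_left, ← gradient_smul]
      rfl
    simp only [e1, e2, integral_const_mul, conj_trivial]
    ring

instance : SeminormedAddCommGroup (smoothSobolev n M) :=
  letI := sobolevCore n M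
  InnerProductSpace.Core.toSeminormedAddCommGroup (𝕜 := ℝ)

instance : InnerProductSpace ℝ (smoothSobolev n M) :=
  InnerProductSpace.ofCore (sobolevCore n M)

/-- The norm `‖f‖_{H¹} = (∫ f² υ_g + ∫ ‖∇f‖² υ_g)^{1/2}`. -/
lemma norm_smoothSobolev (f : smoothSobolev n M) :
    ‖f‖ = Real.sqrt (∫ x, f.1 x ^ 2 ∂(riemannianVolume n M) +
      ∫ x, ‖gradient (n := n) f.1 x‖ ^ 2 ∂(riemannianVolume n M)) := by
  simp only [pow_two (f.1 _), ← real_inner_self_eq_norm_sq]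
  rfl

/-- The Sobolev space `H¹(M)`: the completion of the space of smooth functions `f` with `f` and
`‖∇f‖` square integrable, with respect to the `H¹` norm. -/
abbrev SobolevH1 (n : ℕ) (M : Type*) [TopologicalSpace M] [ChartedSpace (Model n) M]
    [IsManifold (𝓡 n) ∞ M] [Bundle.RiemannianBundle (fun x : M => TangentSpace (𝓡 n) x)]
    [IsContMDiffRiemannianBundle (𝓡 n) ∞ (Model n) (fun x : M => TangentSpace (𝓡 n) x)]
    [MeasurableSpace M] [BorelSpace M] : Type _ :=
  UniformSpace.Completion (smoothSobolev n M)

end Sobolev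

end RiemannianSobolev

end

/-!
By Cauchy–Schwarz, `|X f| = |g(∇f, X)| ≤ ‖X‖_∞ ‖∇f‖` pointwise. The supremum `‖X‖_∞` is finite
because `x ↦ ‖X x‖` is continuous and vanishes off a compact set
(`VectorField.bddAbove_range_norm`). Integrating the square of the pointwise bound gives
`‖X f‖_{L²} ≤ ‖X‖_∞ ‖f‖_{H¹}` (`norm_sobolevDerivative_le`), so the linear map `f ↦ X f` extends,
with the same bound, to the completion `H¹(M)`. The extension is unique because the smooth
functions are dense there.
-/

namespace RiemannianSobolev

/-- A bounded linear map into a Banach space extends uniquely to the completion of its domain, with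
the same bound. -/
lemma exists_unique_extension_completion {E F : Type*} [SeminormedAddCommGroup E]
    [NormedSpace ℝ E] [NormedAddCommGroup F] [NormedSpace ℝ F] [CompleteSpace F]
    (D : E →ₗ[ℝ] F) {C : ℝ} (hC : 0 ≤ C) (hD : ∀ x, ‖D x‖ ≤ C * ‖x‖) :
    ∃ T : UniformSpace.Completion E →L[ℝ] F, (∀ x : E, T x = D x) ∧
      (∀ T' : UniformSpace.Completion E →L[ℝ] F, (∀ x : E, T' x = D x) → T' = T) ∧
      ‖T‖ ≤ C := by
  let e : E →ₗ[ℝ] UniformSpace.Completion E :=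
    (UniformSpace.Completion.toComplL : E →L[ℝ] UniformSpace.Completion E)
  have hdense : DenseRange e := UniformSpace.Completion.denseRange_coe
  have hbound (x : E) : ‖D x‖ ≤ C * ‖e x‖ :=
    (hD x).trans_eq (congrArg (C * ·) (UniformSpace.Completion.norm_coe x).symm)
  exact ⟨D.extendOfNorm e, LinearMap.extendOfNorm_eq hdense ⟨C, hbound⟩,
    fun T' hT' => (LinearMap.extendOfNorm_unique hdense C hbound T' (LinearMap.ext hT')).symm,
    LinearMap.opNorm_extendOfNorm_le hdense hC hbound⟩

variable {n : ℕ} {M : Type*} [TopologicalSpace M] [ChartedSpace (Model n) M]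
  [IsManifold (𝓡 n) ∞ M] [Bundle.RiemannianBundle (fun x : M => TangentSpace (𝓡 n) x)]

lemma VectorField.supNorm_nonneg (X : VectorField n M) : 0 ≤ X.supNorm :=
  Real.iSup_nonneg fun _ => norm_nonneg _

lemma norm_applyField_le (X : VectorField n M) (hX : BddAbove (Set.range fun x : M => ‖X x‖))
    (f : Smooth n M) (x : M) :
    ‖applyField X f x‖ ≤ X.supNorm * ‖gradient (n := n) f x‖ := by
  rw [applyField_apply, ← inner_gradient, mul_comm]
  exact (norm_inner_le_norm _ _).trans
    (mul_le_mul_of_nonneg_left (le_ciSup hX x) (norm_nonneg _))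

variable [IsContMDiffRiemannianBundle (𝓡 n) ∞ (Model n) (fun x : M => TangentSpace (𝓡 n) x)]

lemma VectorField.continuous_norm (X : VectorField n M) : Continuous fun x : M => ‖X x‖ := by
  have h : Continuous fun x : M => inner ℝ (X x) (X x) :=
    continuous_iff_continuousAt.2 fun x =>
      ((X.contMDiff x).inner_bundle (X.contMDiff x)).continuousAt
  simpa only [norm_eq_sqrt_real_inner] using h.sqrt

lemma VectorField.bddAbove_range_norm (X : VectorField n M)
    (hX : IsCompact (closure {x : M | X x ≠ 0})) :
    BddAbove (Set.range fun x : M => ‖X x‖) := by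
  obtain ⟨C, hC⟩ := hX.bddAbove_image X.continuous_norm.continuousOn
  refine ⟨max C 0, ?_⟩
  rintro _ ⟨x, rfl⟩
  by_cases hx : X x = 0
  · simp [hx]
  · exact (hC ⟨x, subset_closure hx, rfl⟩).trans (le_max_left _ _)

variable [MeasurableSpace M] [BorelSpace M]

lemma memLp_applyField (X : VectorField n M) (hX : BddAbove (Set.range fun x : M => ‖X x‖))
    (f : smoothSobolev n M) : MemLp (applyField X f.1) 2 (riemannianVolume n M) := by
  refine f.2.2.of_le_mul (c := X.supNorm)
    (applyField X f.1).contMDiff.continuous.measurable.aestronglyMeasurable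
    (ae_of_all _ fun x => ?_)
  rw [norm_norm]
  exact norm_applyField_le X hX f.1 x

/-- The derivation `f ↦ X f` as a linear map from the square integrable smooth functions with
square integrable gradient to `L²(M, υ_g)`, for a bounded vector field `X`. -/
noncomputable def sobolevDerivative (X : VectorField n M) (hX : BddAbove (Set.range fun x : M => ‖X x‖)) :
    smoothSobolev n M →ₗ[ℝ] Lp ℝ 2 (riemannianVolume n M) where
  toFun f := (memLp_applyField X hX f).toLp _
  map_add' f h := by
    rw [← MemLp.toLp_add]
    exact MemLp.toLp_congr _ _
      (ae_of_all _ fun x => DFunLike.congr_fun (X.toDerivation.map_add f.1 h.1) x)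
  map_smul' c f := by
    rw [RingHom.id_apply, ← MemLp.toLp_const_smul]
    exact MemLp.toLp_congr _ _
      (ae_of_all _ fun x => DFunLike.congr_fun (X.toDerivation.map_smul c f.1) x)

lemma norm_sobolevDerivative_le (X : VectorField n M)
    (hX : BddAbove (Set.range fun x : M => ‖X x‖)) (f : smoothSobolev n M) :
    ‖sobolevDerivative X hX f‖ ≤ X.supNorm * ‖f‖ := by
  -- The comparison function is the class of `‖∇f‖` in `L²`, whose norm is at most `‖f‖_{H¹}`.
  set G : Lp ℝ 2 (riemannianVolume n M) := f.2.2.toLp _ with hG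
  have hGf : ‖G‖ ≤ ‖f‖ := by
    rw [norm_smoothSobolev, norm_eq_sqrt_real_inner, L2.inner_def]
    refine Real.sqrt_le_sqrt ?_
    have e : ∫ x, inner ℝ (G x) (G x) ∂(riemannianVolume n M) =
        ∫ x, ‖gradient (n := n) f.1 x‖ ^ 2 ∂(riemannianVolume n M) := by
      refine integral_congr_ae ?_
      filter_upwards [f.2.2.coeFn_toLp] with x hx
      rw [hG, hx, real_inner_self_eq_norm_sq, norm_norm]
    rw [e]
    exact le_add_of_nonneg_left (integral_nonneg fun _ => sq_nonneg _)
  refine (Lp.norm_le_mul_norm_of_ae_le_mul (g := G) ?_).trans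
    (mul_le_mul_of_nonneg_left hGf X.supNorm_nonneg)
  filter_upwards [(memLp_applyField X hX f).coeFn_toLp, f.2.2.coeFn_toLp] with x h1 h2
  rw [hG, h2, norm_norm]
  exact (congrArg norm h1).trans_le (norm_applyField_le X hX f.1 x)

end RiemannianSobolev

theorem mainTheorem6 (n : ℕ) (M : Type*) [TopologicalSpace M] [T2Space M]
    [SecondCountableTopology M] [ChartedSpace (RiemannianSobolev.Model n) M]
    [IsManifold (𝓡 n) ∞ M] [Bundle.RiemannianBundle (fun x : M => TangentSpace (𝓡 n) x)]
    [IsContMDiffRiemannianBundle (𝓡 n) ∞ (RiemannianSobolev.Model n)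
      (fun x : M => TangentSpace (𝓡 n) x)]
    [MeasurableSpace M] [BorelSpace M]
    (X : RiemannianSobolev.VectorField n M) (hX : IsCompact (closure {x : M | X x ≠ 0})) :
    ∃ T : RiemannianSobolev.SobolevH1 n M →L[ℝ] Lp ℝ 2 (RiemannianSobolev.riemannianVolume n M),
      (∀ f : RiemannianSobolev.smoothSobolev n M,
        T (f : RiemannianSobolev.SobolevH1 n M) =ᵐ[RiemannianSobolev.riemannianVolume n M]
          X.toDerivation (f : RiemannianSobolev.Smooth n M)) ∧
      (∀ T' : RiemannianSobolev.SobolevH1 n M →L[ℝ] Lp ℝ 2 (RiemannianSobolev.riemannianVolume n M),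
        (∀ f : RiemannianSobolev.smoothSobolev n M,
          T' (f : RiemannianSobolev.SobolevH1 n M) =ᵐ[RiemannianSobolev.riemannianVolume n M]
            X.toDerivation (f : RiemannianSobolev.Smooth n M)) → T' = T) ∧
      ‖T‖ ≤ X.supNorm := by
  have hb := X.bddAbove_range_norm hX
  have hD (f : RiemannianSobolev.smoothSobolev n M) :
      RiemannianSobolev.sobolevDerivative X hb f =ᵐ[RiemannianSobolev.riemannianVolume n M]
        X.toDerivation (f : RiemannianSobolev.Smooth n M) :=
    (RiemannianSobolev.memLp_applyField X hb f).coeFn_toLp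
  obtain ⟨T, hT, hunique, hnorm⟩ := RiemannianSobolev.exists_unique_extension_completion
    (RiemannianSobolev.sobolevDerivative X hb) X.supNorm_nonneg
    (RiemannianSobolev.norm_sobolevDerivative_le X hb)
  refine ⟨T, fun f => ?_, fun T' hT' => hunique T' fun f => ?_, hnorm⟩
  · rw [hT f]
    exact hD f
  · exact Lp.ext ((hT' f).trans (hD f).symm)
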